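/- A canonical Local Friendliness (LF) scenario $S$ consists of agents $I_A=\{1,\dots,N\}$, a subset $I_F\subset I_A$ of agents that have a friend, for each agent $i$ a finite set $M_i\ni 1$ of measurements, and for each $x_i\in M_i$ a finite set $O_{x_i}$ of outcomes, where $I_A$, all $M_i$ and all $O_{x_i}$ have at least two elements. The measurement $1$ is called the query measurement. A behaviour $\wp$ assigns to each context $\vec x\in\prod_i M_i$ a probability distribution $\wp(\cdot\,|\vec x)$ on $\prod_i O_{x_i}$; it is regarded as a point of $\mathbb R^D$ with $D=\sum_{\vec x}\prod_i|O_{x_i}|$. It is no-signalling if, for each $i$, the distribution of the outcomes of all agents other than $i$ does not depend on $x_i$; it satisfies Local Agency if, for each $V\subset I_A$, the marginal $\wp(\vec a_V|\vec x)$ depends on $\vec x$ only through $\vec x_V$. For a context $\vec x$ put $F_{\vec x}=\{i\in I_F: x_i=1\}$ and $J_{\vec x}=I_A\setminus F_{\vec x}$. The set $\mathcal{LF}(S)$ consists of all $\wp$ of the form $$\wp(\vec a|\vec x)=\sum_{\vec c}\Big(\prod_{i\in F_{\vec x}}\delta_{a_i,c_i}\Big)\,P(\vec a_{J_{\vec x}}|\vec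 x_{J_{\vec x}},\vec c)\,P(\vec c),$$ where $\vec c=(c_i)_{i\in I_F}$ ranges over $\prod_{i\in I_F}O_{x_i=1}$, $P(\vec c)$ is a probability distribution, and for each $\vec c$ the $P(\vec a_{J_{\vec x}}|\vec x_{J_{\vec x}},\vec c)$ are marginals of a behaviour $P(\vec a|\vec x,\vec c)$ satisfying Local Agency. Let $S_p'$ be the reduced scenario, with the same agents and outcomes, in which the agents $i\in I_F$ may only choose measurements in $M_i\setminus\{1\}$ (the others may choose in $M_i$), and let $\mathcal{NS}(S_p')$ be its set of no-signalling behaviours. **Theorem.** For every canonical LF scenario $S$, the set $\mathcal{LF}(S)$ is a convex polytope, that is, the convex hull of a finite set of points. Its extreme points are exactly the points $$\wp_{\vec c,e}(\vec a|\vec x)=\Big(\prod_{i\in F_{\vec x}}\delta_{a_i,c_i}\Big)\cdot e(\vec a_{J_{\vec x}}|\vec x_{J_{\vec x}}),\qquad \vec c\in\prod_{i\in I_F}O_{x_i=1},\quad e \text{ an extreme point of } \mathcal{NS}(S_p'),$$ where $e(\vec a_{J_{\vec x}}|\vec x_{J_{\vec x}})$ is the marginal of $e(\cdot\,|\vec x')$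 for any context $\vec x'$ of $S_p'$ with $\vec x'_{J_{\vec x}}=\vec x_{J_{\vec x}}$ (by no-signalling it does not depend on the choice of $\vec x'$). Distinct pairs $(\vec c,e)$ give distinct extreme points. -/

import Mathlib

noncomputable section

namespace LocalFriendliness

/-- A public (Bell) scenario: `N` agents, agent `i` has the finite set `M i` of measurement labels,
and `O i s` is the finite set of outcome labels of the measurement `s` of agent `i`
(only the values at `s ∈ M i` matter). -/
structure PublicScenario where
  N : ℕ
  M : Fin N → Finset ℕ
  O : Fin N → ℕ → Finset ℕ

namespace PublicScenario

variable (S : PublicScenario)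

/-- Strings `x` of measurement choices. -/
abbrev Context : Type := (i : Fin S.N) → S.M i

/-- Strings `a` of outcomes in the context `x`. -/
abbrev Outcome (x : S.Context) : Type := (i : Fin S.N) → S.O i (x i)

/-- Families of real numbers `p(a | x)`, that is, the space `ℝ ^ D` with `D = ∑ x, |O_x|`. -/
abbrev Table : Type := (x : S.Context) → S.Outcome x → ℝ

variable {S}

/-- A behaviour: a probability distribution of the outcomes for each context. -/
def IsBehaviour (p : S.Table) : Prop :=
  (∀ x a, 0 ≤ p x a) ∧ ∀ x, ∑ a, p x a = 1

/-- The marginal probability `p(a_V | x)`: the sum of `p(b | x)` over all outcome strings `b`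
that agree with the string of labels `a` on the set `V` of parties. -/
def marginal (p : S.Table) (V : Finset (Fin S.N)) (x : S.Context) (a : Fin S.N → ℕ) : ℝ :=
  ∑ b : S.Outcome x with ∀ i ∈ V, (b i : ℕ) = a i, p x b

/-- Local Agency: for each set `V` of parties, `p(a_V | x)` depends on `x` only through `x_V`. -/
def LocalAgency (p : S.Table) : Prop :=
  ∀ (V : Finset (Fin S.N)) (x y : S.Context), (∀ i ∈ V, x i = y i) →
    ∀ a : Fin S.N → ℕ, marginal p V x a = marginal p V y a

/-- The no-signalling constraints: after summing over the outcome of any one party `i`, the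
distribution of the other outcomes does not depend on the measurement choice of `i`. -/
def NoSignalling (p : S.Table) : Prop :=
  ∀ (i : Fin S.N) (x y : S.Context), (∀ j ≠ i, x j = y j) →
    ∀ a : Fin S.N → ℕ, marginal p (Finset.univ.erase i) x a = marginal p (Finset.univ.erase i) y a

variable (S) in
/-- The set of no-signalling behaviours. -/
def NS : Set S.Table := {p | IsBehaviour p ∧ NoSignalling p}

theorem marginal_eq_sum_erase (p : S.Table) (V : Finset (Fin S.N)) (i : Fin S.N) (hi : i ∉ V)
    (x : S.Context) (a : Fin S.N → ℕ) :
    marginal p V x a =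
      ∑ t ∈ (Fintype.piFinset fun j => if j = i then {0} else S.O j (x j)) with
        ∀ j ∈ V, t j = a j, marginal p (Finset.univ.erase i) x t := by
  unfold marginal
  rw [← Finset.sum_fiberwise_of_maps_to
    (g := fun (b : S.Outcome x) (j : Fin S.N) => if j = i then 0 else (b j : ℕ))]
  · refine Finset.sum_congr rfl fun t ht => ?_
    refine Finset.sum_congr ?_ fun _ _ => rfl
    simp only [Finset.mem_filter, Fintype.mem_piFinset] at ht
    ext b
    simp only [Finset.mem_filter, Finset.mem_univ, true_and, Finset.mem_erase, and_true]
    constructor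
    · rintro ⟨-, h⟩ j hj
      have := congrFun h j
      simpa [hj] using this
    · intro h
      refine ⟨fun j hj => ?_, ?_⟩
      · rw [h j (by rintro rfl; exact hi hj), ht.2 j hj]
      · funext j
        by_cases hj : j = i
        · have := ht.1 j
          simp [hj] at this ⊢
          exact this.symm
        · simp [hj, h j hj]
  · intro b hb
    simp only [Finset.mem_filter, Finset.mem_univ, true_and, Fintype.mem_piFinset] at hb ⊢
    refine ⟨fun j => ?_, fun j hj => ?_⟩
    · by_cases hj : j = i <;> simp [hj]
    · have : j ≠ i := by rintro rfl; exact hi hj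
      simp [this, hb j hj]

/-- The no-signalling constraints for single parties imply those for all sets of parties. -/
theorem NoSignalling.localAgency {p : S.Table} (h : NoSignalling p) : LocalAgency p := by
  have step : ∀ (V : Finset (Fin S.N)) (i : Fin S.N), i ∉ V → ∀ x y : S.Context,
      (∀ j ≠ i, x j = y j) → ∀ a, marginal p V x a = marginal p V y a := by
    intro V i hi x y hxy a
    rw [marginal_eq_sum_erase p V i hi, marginal_eq_sum_erase p V i hi]
    have : (fun j => if j = i then ({0} : Finset ℕ) else S.O j (x j)) =
        fun j => if j = i then {0} else S.O j (y j) := by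
      funext j
      by_cases hj : j = i
      · simp [hj]
      · simp [hj, hxy j hj]
    rw [this]
    exact Finset.sum_congr rfl fun t _ => h i x y hxy t
  intro V x y hxy a
  have key : ∀ (D : Finset (Fin S.N)), Disjoint D V → ∀ y : S.Context,
      (∀ j ∉ D, x j = y j) → marginal p V x a = marginal p V y a := by
    intro D
    induction D using Finset.induction_on with
    | empty =>
      intro _ y hy
      rw [show x = y from funext fun j => hy j (by simp)]
    | insert i D hiD ih =>
      intro hD y hy
      rw [Finset.disjoint_insert_left] at hD
      rw [ih hD.2 (Function.update y i (x i))]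
      · exact step V i hD.1 _ _ (fun j hj => by simp [hj]) a
      · intro j hj
        by_cases hji : j = i
        · subst hji; simp
        · simp [hji, hy j (by simp [hji, hj])]
  refine key Vᶜ disjoint_compl_left y fun j hj => hxy j ?_
  simpa using hj

end PublicScenario

/-- A canonical Local Friendliness scenario: a public scenario with a set `friends` of agents that
have a friend; the measurement with label `1` is the query measurement. -/
structure CanonicalScenario extends PublicScenario where
  friends : Finset (Fin N)
  two_le_N : 2 ≤ N
  one_mem : ∀ i, 1 ∈ M i
  two_le_card_M : ∀ i, 2 ≤ (M i).card
  two_le_card_O : ∀ i, ∀ s ∈ M i, 2 ≤ (O i s).card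

namespace CanonicalScenario

open PublicScenario

variable (S : CanonicalScenario)

/-- Strings `c` of outcomes of the friends, `c i` being an outcome of the query measurement. -/
abbrev FriendOutcome : Type := (i : S.friends) → S.O i 1

variable {S}

/-- The set `F_x` of the agents with a friend that choose the query measurement in `x`. -/
def querying (x : S.Context) : Finset (Fin S.N) :=
  S.friends.filter fun i => (x i : ℕ) = 1

/-- The product over `i ∈ F_x` of the Kronecker deltas of `a i` and `c i`. -/
def queryDelta (c : S.FriendOutcome) (x : S.Context) (a : S.Outcome x) : ℝ :=
  ∏ i : S.friends with i.1 ∈ querying x, if (a i.1 : ℕ) = c i then 1 else 0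

variable (S) in
/-- The set of Local Friendliness behaviours: those of the form
`p(a | x) = ∑ c, (∏ i ∈ F_x, δ (a i) (c i)) * P(a_J | x_J, c) * P(c)`, where `J` is the complement
of `F_x`, `P(c)` is a probability distribution, and for each `c` the `P(a_J | x_J, c)` are
probability distributions that satisfy Local Agency. -/
def LF : Set S.Table :=
  {p | ∃ (w : S.FriendOutcome → ℝ) (P : S.FriendOutcome → S.Table),
    (∀ c, 0 ≤ w c) ∧ ∑ c, w c = 1 ∧ (∀ c, IsBehaviour (P c) ∧ LocalAgency (P c)) ∧
    ∀ x a, p x a =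
      ∑ c, queryDelta c x a * marginal (P c) (querying x)ᶜ x (fun i => a i) * w c}

variable (S) in
/-- The reduced public scenario, in which no agent with a friend can choose the query
measurement. -/
def reduced : PublicScenario where
  N := S.N
  M := fun i => if i ∈ S.friends then (S.M i).erase 1 else S.M i
  O := S.O

theorem exists_avoid (x : S.Context) :
    ∃ x' : S.reduced.Context, ∀ i, i ∉ querying x → (x' i : ℕ) = x i := by
  have : ∀ i : Fin S.N, ∃ s : S.reduced.M i, i ∉ querying x → (s : ℕ) = x i := by
    intro i
    by_cases hi : i ∈ S.friends
    · by_cases hx : (x i : ℕ) = 1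
      · obtain ⟨s, hs, hs1⟩ := Finset.exists_mem_ne (S.two_le_card_M i) 1
        exact ⟨⟨s, by simp [reduced, hi, hs, hs1]⟩, fun h => absurd (by simp [querying, hi, hx]) h⟩
      · exact ⟨⟨x i, by simp [reduced, hi, hx]⟩, fun _ => rfl⟩
    · exact ⟨⟨x i, by simp [reduced, hi]⟩, fun _ => rfl⟩
  choose x' hx' using this
  exact ⟨x', hx'⟩

/-- A context of the reduced scenario that agrees with `x` except for the agents in `F_x`. -/
def avoid (x : S.Context) : S.reduced.Context := (exists_avoid x).choose

theorem avoid_eq (x : S.Context) (i : Fin S.N) (hi : i ∉ querying x) :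
    (avoid x i : ℕ) = x i := (exists_avoid x).choose_spec i hi

/-- The table `(∏ i ∈ F_x, δ (a i) (c i)) * e(a_J | x_J)`, where `J` is the complement of `F_x`:
deterministic outcomes `c` for the query measurements, combined with the marginals of a
no-signalling behaviour `e` of the reduced scenario. -/
def combine (c : S.FriendOutcome) (e : S.reduced.Table) : S.Table := fun x a =>
  queryDelta c x a * marginal e (querying x)ᶜ (avoid x) (fun i => a i)

/-- In `combine`, any context of the reduced scenario that agrees with `x` on the complement of
`F_x` gives the same marginals. -/
theorem combine_eq (c : S.FriendOutcome) {e : S.reduced.Table} (he : e ∈ S.reduced.NS)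
    (x : S.Context) (x' : S.reduced.Context) (h : ∀ i ∉ querying x, (x' i : ℕ) = x i)
    (a : S.Outcome x) :
    combine c e x a =
      queryDelta c x a * marginal e (S := S.reduced) (querying x)ᶜ x' (fun i => a i) := by
  unfold combine
  congr 1
  refine he.2.localAgency _ _ _ (fun i hi => Subtype.ext ?_) _
  have hi' : i ∉ querying x := Finset.mem_compl.mp hi
  exact (avoid_eq x i hi').trans (h i hi').symm

end CanonicalScenario

/-- A convex polytope is the convex hull of a finite set of points. -/
def IsConvexPolytope {E : Type*} [AddCommGroup E] [Module ℝ E] (K : Set E) : Prop :=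
  ∃ V : Set E, V.Finite ∧ K = convexHull ℝ V

end LocalFriendliness

end

noncomputable section

namespace LocalFriendliness

open Set

/-! ### The no-signalling polytope of a public scenario. -/

namespace PublicScenario

variable {S : PublicScenario}

/-! For fixed `c`, the map `combine c` is linear and has `restrict` as a left inverse on
no-signalling behaviours, so it embeds `NS` of the reduced scenario in `LF`. In the definition of
`LF`, `P c` matters only through marginals outside the querying set, and Local Agency makes these
marginals of `restrict (P c)`; hence `LF` consists of the mixtures over `c` of points of these
embedded polytopes (`mem_LF_iff`). As `NS` is the hull of its finitely many extreme points, `LF` is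
the hull of their images, and every extreme point of `LF` is among these. Conversely, each image is
extreme (`combine_mem_extremePoints`). In the context where everybody queries, the friends' outcomes
are visible, so a point of `LF` supported within `combine c e` uses only the string `c`
(`eq_combine_of_support_subset`). A decomposition of `combine c e` therefore stays in the copy of
`NS` belonging to `c`, where `restrict` turns it into a decomposition of `e`. -/

theorem marginal_univ (p : S.Table) (x : S.Context) (a : S.Outcome x) :
    marginal p Finset.univ x (fun i => a i) = p x a := by
  unfold marginal
  rw [Finset.sum_eq_single a]
  · intro b hb hne
    refine absurd (funext fun i => Subtype.ext ?_) hne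
    simpa using (Finset.mem_filter.1 hb).2 i (Finset.mem_univ i)
  · intro h
    exact absurd (by simp) h

theorem marginal_empty (p : S.Table) (x : S.Context) (a : Fin S.N → ℕ) :
    marginal p ∅ x a = ∑ b, p x b := by
  simp [marginal]

theorem marginal_nonneg {p : S.Table} (hp : ∀ x a, 0 ≤ p x a) (V : Finset (Fin S.N))
    (x : S.Context) (a : Fin S.N → ℕ) : 0 ≤ marginal p V x a :=
  Finset.sum_nonneg fun b _ => hp x b

theorem marginal_add (p q : S.Table) (V : Finset (Fin S.N)) (x : S.Context) (a : Fin S.N → ℕ) :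
    marginal (p + q) V x a = marginal p V x a + marginal q V x a := by
  simp [marginal, Finset.sum_add_distrib]

theorem marginal_smul (r : ℝ) (p : S.Table) (V : Finset (Fin S.N)) (x : S.Context)
    (a : Fin S.N → ℕ) : marginal (r • p) V x a = r * marginal p V x a := by
  simp [marginal, Finset.mul_sum]

theorem LocalAgency.noSignalling {p : S.Table} (h : LocalAgency p) : NoSignalling p :=
  fun _ x y hxy a => h _ x y (fun j hj => hxy j (Finset.ne_of_mem_erase hj)) a

/-- The no-signalling behaviours are cut out by linear equations and positivity. -/
theorem lineMap_mem_NS {p q : S.Table} (hp : p ∈ S.NS) (hq : q ∈ S.NS) {s t : ℝ}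
    (hst : s + t = 1) (hpos : ∀ x a, 0 ≤ s * p x a + t * q x a) : s • p + t • q ∈ S.NS := by
  refine ⟨⟨fun x a => by simpa using hpos x a, fun x => ?_⟩, fun i x y hxy a => ?_⟩
  · simp [Finset.sum_add_distrib, ← Finset.mul_sum, hp.1.2 x, hq.1.2 x, hst]
  · simp only [marginal_add, marginal_smul, hp.2 i x y hxy a, hq.2 i x y hxy a]

theorem convex_NS : Convex ℝ S.NS := fun _ hp _ hq _ _ hs ht hst =>
  lineMap_mem_NS hp hq hst fun x a =>
    add_nonneg (mul_nonneg hs (hp.1.1 x a)) (mul_nonneg ht (hq.1.1 x a))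

theorem IsBehaviour.le_one {p : S.Table} (hp : IsBehaviour p) (x : S.Context) (a : S.Outcome x) :
    p x a ≤ 1 :=
  (hp.2 x).le.trans' (Finset.single_le_sum (fun b _ => hp.1 x b) (Finset.mem_univ a))

theorem isCompact_NS : IsCompact S.NS := by
  refine (isCompact_Icc (a := (0 : S.Table)) (b := 1)).of_isClosed_subset ?_
    fun p hp => ⟨fun x a => hp.1.1 x a, fun x a => hp.1.le_one x a⟩
  have hm : ∀ V x a, Continuous fun p : S.Table => marginal p V x a := fun V x a => by
    unfold marginal
    fun_prop
  have h : S.NS = (⋂ x, ⋂ a, {p : S.Table | 0 ≤ p x a}) ∩ (⋂ x, {p : S.Table | ∑ a, p x a = 1}) ∩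
      ⋂ (i : Fin S.N), ⋂ (x : S.Context), ⋂ (y : S.Context), ⋂ (_ : ∀ j ≠ i, x j = y j),
        ⋂ (a : Fin S.N → ℕ), {p : S.Table |
          marginal p (Finset.univ.erase i) x a = marginal p (Finset.univ.erase i) y a} := by
    ext p
    simp [NS, IsBehaviour, NoSignalling]
  rw [h]
  refine IsClosed.inter (IsClosed.inter ?_ ?_) ?_
  · exact isClosed_iInter fun x => isClosed_iInter fun a =>
      isClosed_le continuous_const (by fun_prop)
  · exact isClosed_iInter fun x => isClosed_eq (by fun_prop) continuous_const
  · exact isClosed_iInter fun i => isClosed_iInter fun x => isClosed_iInter fun y =>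
      isClosed_iInter fun _ => isClosed_iInter fun a => isClosed_eq (hm _ _ _) (hm _ _ _)

/-- An extreme no-signalling behaviour is the only no-signalling behaviour with support contained
in its own. -/
theorem eq_of_support_subset {p q : S.Table} (hp : p ∈ extremePoints ℝ S.NS) (hq : q ∈ S.NS)
    (hs : ∀ x a, p x a = 0 → q x a = 0) : p = q := by
  obtain ⟨ε, hε, hεp⟩ : ∃ ε : ℝ, 0 < ε ∧ ∀ x a, p x a ≠ 0 → ε ≤ p x a := by
    let T : Finset ℝ := (Finset.univ.image fun i : Σ x : S.Context, S.Outcome x => p i.1 i.2).filter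
      (0 < ·)
    have hT : ∀ x a, p x a ≠ 0 → p x a ∈ T := fun x a h => Finset.mem_filter.2
      ⟨Finset.mem_image.2 ⟨⟨x, a⟩, Finset.mem_univ _, rfl⟩, lt_of_le_of_ne (hp.1.1.1 x a) h.symm⟩
    rcases T.eq_empty_or_nonempty with h | h
    · exact ⟨1, one_pos, fun x a hxa => by simpa [h] using hT x a hxa⟩
    · exact ⟨T.min' h, (Finset.mem_filter.1 (T.min'_mem h)).2,
        fun x a hxa => T.min'_le _ (hT x a hxa)⟩
  -- Move `p` slightly away from `q`. Positivity survives: where `p` vanishes so does `q`, and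
  -- elsewhere `p ≥ ε ≥ ε * q` because `q ≤ 1`. Then `p` lies strictly between the new point and
  -- `q`.
  have h₁ : (1 + ε) • p + (-ε) • q ∈ S.NS := by
    refine lineMap_mem_NS hp.1 hq (by ring) fun x a => ?_
    by_cases h : p x a = 0
    · simp [h, hs x a h]
    · nlinarith [hεp x a h, hp.1.1.1 x a, hq.1.le_one x a]
  have h₂ : (1 + ε)⁻¹ • ((1 + ε) • p + (-ε) • q) + (ε * (1 + ε)⁻¹) • q = p := by
    have : (1 + ε) ≠ 0 := by positivity
    ext x a
    simp
    field_simp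
    ring
  have h₃ : (1 + ε)⁻¹ + ε * (1 + ε)⁻¹ = 1 := by
    have : (1 + ε) ≠ 0 := by positivity
    field_simp
  exact ((mem_extremePoints.1 hp).2 _ h₁ q hq
    ⟨(1 + ε)⁻¹, ε * (1 + ε)⁻¹, by positivity, by positivity, h₃, h₂⟩).2.symm

/-- An extreme point is determined by its zero set, and there are finitely many zero sets. -/
theorem finite_extremePoints_NS : (extremePoints ℝ S.NS).Finite := by
  refine Set.Finite.of_finite_image
    (f := fun p => {i : Σ x : S.Context, S.Outcome x | p i.1 i.2 = 0})
    (Set.toFinite _) fun p hp q hq h => eq_of_support_subset hp hq.1 fun x a hxa => ?_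
  exact (Set.ext_iff.1 h ⟨x, a⟩).1 hxa

/-- Krein–Milman; the closure is superfluous since the hull of a finite set is compact. -/
theorem convexHull_extremePoints_NS : convexHull ℝ (extremePoints ℝ S.NS) = S.NS := by
  have h := closure_convexHull_extremePoints (isCompact_NS (S := S)) convex_NS
  rwa [(finite_extremePoints_NS.isCompact_convexHull (𝕜 := ℝ)).isClosed.closure_eq] at h

end PublicScenario

namespace CanonicalScenario

open PublicScenario

variable {S : CanonicalScenario}

/-! ### Marginals and Local Agency of `combine c e`. -/

theorem mem_querying {x : S.Context} {i : Fin S.N} :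
    i ∈ querying x ↔ i ∈ S.friends ∧ (x i : ℕ) = 1 := by
  simp [querying]

theorem queryDelta_eq (c : S.FriendOutcome) (x : S.Context) (a : S.Outcome x) :
    queryDelta c x a =
      if ∀ i : S.friends, i.1 ∈ querying x → (a i.1 : ℕ) = c i then 1 else 0 := by
  rw [queryDelta, Finset.prod_ite_zero]
  simp

theorem queryDelta_nonneg (c : S.FriendOutcome) (x : S.Context) (a : S.Outcome x) :
    0 ≤ queryDelta c x a := by
  rw [queryDelta_eq]
  split_ifs <;> simp

/-- Replace the outcomes of the agents in `F_x` by the outcomes `c` of their friends. -/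
def override (c : S.FriendOutcome) (x : S.Context) (b : S.reduced.Outcome (avoid x)) :
    S.Outcome x := fun i =>
  if h : i ∈ querying x then
    ⟨c ⟨i, (mem_querying.1 h).1⟩, (congrArg (fun s => (c ⟨i, (mem_querying.1 h).1⟩ : ℕ) ∈ S.O i s)
      (mem_querying.1 h).2).mpr (c _).2⟩
  else ⟨b i, by rw [← avoid_eq x i h]; exact (b i).2⟩

theorem override_of_mem (c : S.FriendOutcome) (x : S.Context) (b : S.reduced.Outcome (avoid x))
    (i : S.friends) (h : i.1 ∈ querying x) : (override c x b i.1 : ℕ) = c i := by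
  simp [override, h]

theorem override_of_notMem (c : S.FriendOutcome) (x : S.Context)
    (b : S.reduced.Outcome (avoid x)) (i : Fin S.N) (h : i ∉ querying x) :
    (override c x b i : ℕ) = b i := by
  simp [override, h]

/-- `combine c e` is the image of `e` under overriding the outcomes of the query measurements. -/
theorem combine_eq_sum (c : S.FriendOutcome) (e : S.reduced.Table) (x : S.Context)
    (a : S.Outcome x) :
    combine c e x a = ∑ b with override c x b = a, e (avoid x) b := by
  rw [combine, queryDelta_eq, marginal]
  split_ifs with h
  · rw [one_mul]
    refine Finset.sum_congr ?_ fun _ _ => rfl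
    ext b
    simp only [Finset.mem_filter, Finset.mem_univ, true_and]
    constructor
    · intro hb
      funext i
      apply Subtype.ext
      by_cases hi : i ∈ querying x
      · rw [override_of_mem c x b ⟨i, (mem_querying.1 hi).1⟩ hi, h ⟨i, (mem_querying.1 hi).1⟩ hi]
      · rw [override_of_notMem c x b i hi, hb i (Finset.mem_compl.2 hi)]
    · rintro rfl i hi
      exact (override_of_notMem c x b i (Finset.mem_compl.1 hi)).symm
  · rw [zero_mul, Finset.sum_eq_zero]
    intro b hb
    refine absurd (fun i hi => ?_) h
    rw [← (Finset.mem_filter.1 hb).2, override_of_mem c x b i hi]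

/-- Being a push-forward under `override c x`, the table has deterministic outcomes on the querying
agents in `V` and those of `e` on the rest. Normalization and Local Agency are both read off from
this formula. -/
theorem marginal_combine (c : S.FriendOutcome) (e : S.reduced.Table) (V : Finset (Fin S.N))
    (x : S.Context) (a : Fin S.N → ℕ) :
    marginal (combine c e) V x a =
      if ∀ i : S.friends, i.1 ∈ querying x → i.1 ∈ V → a i.1 = c i then
        marginal (S := S.reduced) e (V \ querying x : Finset (Fin S.N)) (avoid x) a else 0 := by
  have h₁ : marginal (combine c e) V x a =
      ∑ b with ∀ i ∈ V, (override c x b i : ℕ) = a i, e (avoid x) b := by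
    rw [marginal, ← Finset.sum_fiberwise_of_maps_to (g := override c x)
      (t := Finset.univ.filter fun b : S.Outcome x => ∀ i ∈ V, (b i : ℕ) = a i)]
    · refine Finset.sum_congr rfl fun b hb => ?_
      rw [combine_eq_sum]
      refine Finset.sum_congr ?_ fun _ _ => rfl
      ext b'
      simp only [Finset.mem_filter, Finset.mem_univ, true_and] at hb ⊢
      constructor
      · rintro rfl
        exact ⟨hb, rfl⟩
      · exact fun h => h.2
    · intro b hb
      simpa using hb
  rw [h₁]
  split_ifs with h
  · refine Finset.sum_congr ?_ fun _ _ => rfl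
    ext b
    simp only [Finset.mem_filter, Finset.mem_univ, true_and]
    constructor
    · intro hb i hi
      have hi' := Finset.mem_sdiff.1 hi
      rw [← hb i hi'.1, override_of_notMem c x b i hi'.2]
    · intro hb i hi
      by_cases hq : i ∈ querying x
      · rw [override_of_mem c x b ⟨i, (mem_querying.1 hq).1⟩ hq,
          h ⟨i, (mem_querying.1 hq).1⟩ hq hi]
      · rw [override_of_notMem c x b i hq]
        exact hb i (Finset.mem_sdiff.2 ⟨hi, hq⟩)
  · refine Finset.sum_eq_zero fun b hb => absurd (fun i hi hV => ?_) h
    rw [← (Finset.mem_filter.1 hb).2 i.1 hV, override_of_mem c x b i hi]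

theorem combine_nonneg (c : S.FriendOutcome) {e : S.reduced.Table} (he : e ∈ S.reduced.NS)
    (x : S.Context) (a : S.Outcome x) : 0 ≤ combine c e x a :=
  mul_nonneg (queryDelta_nonneg c x a) (marginal_nonneg he.1.1 _ _ _)

theorem sum_combine (c : S.FriendOutcome) {e : S.reduced.Table} (he : e ∈ S.reduced.NS)
    (x : S.Context) : ∑ a, combine c e x a = 1 := by
  rw [← marginal_empty _ x fun _ => 0, marginal_combine]
  simp only [Finset.notMem_empty, false_imp_iff, imp_true_iff, if_true]
  rw [Finset.empty_sdiff (querying x)]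
  exact (marginal_empty (S := S.reduced) e _ _).trans (he.1.2 _)

theorem isBehaviour_combine (c : S.FriendOutcome) {e : S.reduced.Table} (he : e ∈ S.reduced.NS) :
    IsBehaviour (combine c e) :=
  ⟨combine_nonneg c he, sum_combine c he⟩

/-- Which agents of `V` query depends only on `x` restricted to `V`, hence so do both ingredients of
`marginal_combine`. -/
theorem localAgency_combine (c : S.FriendOutcome) {e : S.reduced.Table} (he : e ∈ S.reduced.NS) :
    LocalAgency (combine c e) := by
  intro V x y hxy a
  have hq : ∀ i ∈ V, (i ∈ querying x ↔ i ∈ querying y) := fun i hi => by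
    rw [mem_querying, mem_querying, hxy i hi]
  have hV : V \ querying x = V \ querying y := by
    ext i
    simp only [Finset.mem_sdiff]
    exact and_congr_right fun hi => not_congr (hq i hi)
  have hc : (∀ i : S.friends, i.1 ∈ querying x → i.1 ∈ V → a i.1 = c i) ↔
      ∀ i : S.friends, i.1 ∈ querying y → i.1 ∈ V → a i.1 = c i :=
    ⟨fun h i hi hV => h i ((hq _ hV).2 hi) hV, fun h i hi hV => h i ((hq _ hV).1 hi) hV⟩
  rw [marginal_combine, marginal_combine, hV]
  simp only [hc]
  congr 1
  refine he.2.localAgency _ _ _ (fun i hi => Subtype.ext ?_) _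
  have hi' := Finset.mem_sdiff.1 hi
  rw [avoid_eq y i hi'.2, avoid_eq x i (fun h => hi'.2 ((hq i hi'.1).1 h)), hxy i hi'.1]

/-! ### Restriction to the reduced scenario. -/

/-- A context of the reduced scenario, as a context of the full scenario. -/
def includeContext (x : S.reduced.Context) : S.Context := fun i => ⟨x i, by
  have := (x i).2
  simp only [reduced] at this
  split_ifs at this
  · exact Finset.mem_of_mem_erase this
  · exact this⟩

theorem querying_includeContext (x : S.reduced.Context) : querying (includeContext x) = ∅ := by
  refine Finset.eq_empty_of_forall_notMem fun i hi => ?_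
  obtain ⟨hf, h1⟩ := mem_querying.1 hi
  have := (x i).2
  simp only [reduced, hf, if_true] at this
  exact Finset.ne_of_mem_erase this h1

/-- The restriction of a table to the contexts of the reduced scenario. -/
def restrict (p : S.Table) : S.reduced.Table := fun x a => p (includeContext x) a

theorem restrict_mem_NS {p : S.Table} (hp : IsBehaviour p) (h : LocalAgency p) :
    restrict p ∈ S.reduced.NS :=
  ⟨⟨fun x a => hp.1 (includeContext x) a, fun x => hp.2 (includeContext x)⟩,
    fun i x y hxy a => h.noSignalling i (includeContext x) (includeContext y)
      (fun j hj => Subtype.ext (congrArg Subtype.val (hxy j hj) :)) a⟩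

theorem restrict_combine (c : S.FriendOutcome) {e : S.reduced.Table} (he : e ∈ S.reduced.NS) :
    restrict (combine c e) = e := by
  funext x a
  have hq := querying_includeContext x
  have hd : queryDelta c (includeContext x) a = 1 := by
    refine (queryDelta_eq c (includeContext x) a).trans (if_pos fun i hi => ?_)
    simp [hq] at hi
  have hV : (querying (includeContext x))ᶜ = Finset.univ := by rw [hq, Finset.compl_empty]
  refine (combine_eq c he (includeContext x) x (fun _ _ => rfl) a).trans ?_
  rw [hd, one_mul]
  exact (congrArg (fun V => marginal (S := S.reduced) e V x fun i => a i) hV).trans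
    (marginal_univ (S := S.reduced) e x a)

theorem marginal_eq_marginal_restrict {p : S.Table} (h : LocalAgency p) (x : S.Context)
    (a : Fin S.N → ℕ) :
    marginal p (querying x)ᶜ x a =
      marginal (S := S.reduced) (restrict p) (querying x)ᶜ (avoid x) a :=
  h _ x (includeContext (avoid x))
    (fun i hi => Subtype.ext (avoid_eq x i (Finset.mem_compl.1 hi)).symm) a

theorem marginal_combine_compl (c : S.FriendOutcome) (e : S.reduced.Table) (x : S.Context)
    (a : Fin S.N → ℕ) :
    marginal (combine c e) (querying x)ᶜ x a =
      marginal (S := S.reduced) e (querying x)ᶜ (avoid x) a := by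
  rw [marginal_combine, if_pos fun i hi hi' => absurd hi (Finset.mem_compl.1 hi'),
    sdiff_eq_left.2 (disjoint_compl_left (a := querying x))]
  rfl

/-! ### `LF` as a set of mixtures, and its convexity. -/

/-- Local Friendliness behaviours are the mixtures of the `combine c e`. -/
theorem mem_LF_iff {p : S.Table} : p ∈ S.LF ↔
    ∃ (w : S.FriendOutcome → ℝ) (e : S.FriendOutcome → S.reduced.Table),
      (∀ c, 0 ≤ w c) ∧ ∑ c, w c = 1 ∧ (∀ c, e c ∈ S.reduced.NS) ∧
      p = ∑ c, w c • combine c (e c) := by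
  constructor
  · rintro ⟨w, P, hw, hw1, hP, hp⟩
    refine ⟨w, fun c => restrict (P c), hw, hw1, fun c => restrict_mem_NS (hP c).1 (hP c).2, ?_⟩
    funext x a
    rw [hp]
    simp only [Finset.sum_apply, Pi.smul_apply, smul_eq_mul]
    refine Finset.sum_congr rfl fun c _ => ?_
    rw [marginal_eq_marginal_restrict (hP c).2, combine, mul_comm]
    rfl
  · rintro ⟨w, e, hw, hw1, he, rfl⟩
    -- `combine c (e c)` is itself an extension of `e c` to all contexts that satisfies Local
    -- Agency.
    refine ⟨w, fun c => combine c (e c), hw, hw1,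
      fun c => ⟨isBehaviour_combine c (he c), localAgency_combine c (he c)⟩, fun x a => ?_⟩
    simp only [Finset.sum_apply, Pi.smul_apply, smul_eq_mul]
    refine Finset.sum_congr rfl fun c _ => ?_
    rw [marginal_combine_compl, combine, mul_comm]
    rfl

theorem combine_add (c : S.FriendOutcome) (e f : S.reduced.Table) :
    combine c (e + f) = combine c e + combine c f := by
  funext x a
  simp only [combine, Pi.add_apply, ← mul_add]
  exact congrArg _ (marginal_add (S := S.reduced) e f _ _ _)

theorem combine_smul (c : S.FriendOutcome) (r : ℝ) (e : S.reduced.Table) :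
    combine c (r • e) = r • combine c e := by
  funext x a
  simp only [combine, Pi.smul_apply, smul_eq_mul, mul_left_comm r]
  exact congrArg _ (marginal_smul (S := S.reduced) r e _ _ _)

/-- `combine` as a linear map in the table of the reduced scenario. -/
def combineLinear (c : S.FriendOutcome) : S.reduced.Table →ₗ[ℝ] S.Table where
  toFun := combine c
  map_add' := combine_add c
  map_smul' := combine_smul c

theorem combine_mem_LF (c : S.FriendOutcome) {e : S.reduced.Table} (he : e ∈ S.reduced.NS) :
    combine c e ∈ S.LF := by
  refine mem_LF_iff.2 ⟨Pi.single c 1, fun _ => e, fun c' => ?_, by simp, fun _ => he, ?_⟩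
  · by_cases h : c' = c
    · subst h; simp
    · simp [h]
  · rw [Finset.sum_eq_single c (fun c' _ h => by simp [h]) (by simp)]
    simp

theorem convex_LF : Convex ℝ S.LF := by
  intro p hp q hq s t hs ht hst
  obtain ⟨w, e, hw, hw1, he, rfl⟩ := mem_LF_iff.1 hp
  obtain ⟨v, f, hv, hv1, hf, rfl⟩ := mem_LF_iff.1 hq
  have h : ∀ c, ∃ g ∈ S.reduced.NS,
      (s * w c + t * v c) • g = (s * w c) • e c + (t * v c) • f c := fun c => by
    -- The set identity `(r + r') • K = r • K + r' • K` for convex `K` merges the two behaviours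
    -- without dividing by a total weight that may be zero.
    have := (convex_NS (S := S.reduced)).add_smul (mul_nonneg hs (hw c)) (mul_nonneg ht (hv c))
    have hmem := Set.add_mem_add (Set.smul_mem_smul_set (a := s * w c) (he c))
      (Set.smul_mem_smul_set (a := t * v c) (hf c))
    rw [← this] at hmem
    exact hmem
  choose g hg hgeq using h
  refine mem_LF_iff.2 ⟨fun c => s * w c + t * v c, g,
    fun c => add_nonneg (mul_nonneg hs (hw c)) (mul_nonneg ht (hv c)), ?_, hg, ?_⟩
  · simp [Finset.sum_add_distrib, ← Finset.mul_sum, hw1, hv1, hst]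
  · rw [Finset.smul_sum, Finset.smul_sum, ← Finset.sum_add_distrib]
    refine Finset.sum_congr rfl fun c _ => ?_
    rw [smul_smul, smul_smul]
    exact .symm (by rw [← combine_smul, hgeq, combine_add, combine_smul, combine_smul])

/-! ### Vertices and extreme points of `LF`. -/

variable (S) in
/-- The points `combine c e` with `e` an extreme no-signalling behaviour. -/
def vertices : Set S.Table :=
  (fun μ : S.FriendOutcome × S.reduced.Table => combine μ.1 μ.2) ''
    (Set.univ ×ˢ extremePoints ℝ S.reduced.NS)

theorem finite_vertices : S.vertices.Finite :=
  (Set.finite_univ.prod finite_extremePoints_NS).image _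

theorem LF_eq_convexHull_vertices : S.LF = convexHull ℝ S.vertices := by
  apply Set.Subset.antisymm
  · intro p hp
    obtain ⟨w, e, hw, hw1, he, rfl⟩ := mem_LF_iff.1 hp
    refine (convex_convexHull ℝ _).sum_mem (fun c _ => hw c) hw1 fun c _ => ?_
    have h : e c ∈ convexHull ℝ (extremePoints ℝ S.reduced.NS) :=
      convexHull_extremePoints_NS.symm ▸ he c
    have h' := Set.mem_image_of_mem (combineLinear c) h
    rw [LinearMap.image_convexHull] at h'
    refine convexHull_mono ?_ h'
    rintro _ ⟨f, hf, rfl⟩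
    exact ⟨(c, f), ⟨Set.mem_univ _, hf⟩, rfl⟩
  · refine convexHull_min ?_ convex_LF
    rintro _ ⟨⟨c, e⟩, ⟨-, he⟩, rfl⟩
    exact combine_mem_LF c he.1

variable (S) in
/-- The context in which all agents choose the query measurement. -/
def queryContext : S.Context := fun i => ⟨1, S.one_mem i⟩

/-- If the support of a mixture lies in that of some `combine c e`, then only the friends' outcomes
`c` contribute to the mixture. -/
theorem eq_combine_of_support_subset {c : S.FriendOutcome} {e : S.reduced.Table} {p : S.Table}
    (hp : p ∈ S.LF) (h : ∀ x a, combine c e x a = 0 → p x a = 0) :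
    ∃ f ∈ S.reduced.NS, p = combine c f := by
  obtain ⟨w, f, hw, hw1, hf, rfl⟩ := mem_LF_iff.1 hp
  have hzero : ∀ c', c' ≠ c → w c' = 0 := by
    intro c' hc
    -- A possible outcome under `c'` when everybody queries shows `c'` at the friends, so it is
    -- impossible under `c ≠ c'`; a positive weight `w c'` would violate the support condition
    -- there.
    obtain ⟨a, -, ha⟩ : ∃ a ∈ Finset.univ, combine c' (f c') S.queryContext a ≠ 0 := by
      refine Finset.exists_ne_zero_of_sum_ne_zero ?_
      rw [sum_combine c' (hf c')]
      exact one_ne_zero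
    have hq : ∀ i : S.friends, i.1 ∈ querying S.queryContext := fun i =>
      mem_querying.2 ⟨i.2, rfl⟩
    have hc' : ∀ i : S.friends, (a i.1 : ℕ) = c' i := by
      by_contra hcon
      refine ha ?_
      rw [combine, queryDelta_eq, if_neg fun hall => hcon fun i => hall i (hq i), zero_mul]
    have h0 : combine c e S.queryContext a = 0 := by
      rw [combine, queryDelta_eq, if_neg, zero_mul]
      exact fun hall => hc (funext fun i => Subtype.ext ((hc' i).symm.trans (hall i (hq i))))
    have hsum := h _ _ h0
    simp only [Finset.sum_apply, Pi.smul_apply, smul_eq_mul] at hsum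
    rw [Finset.sum_eq_zero_iff_of_nonneg
      fun d _ => mul_nonneg (hw d) (combine_nonneg d (hf d) _ _)] at hsum
    exact (mul_eq_zero.1 (hsum c' (Finset.mem_univ _))).resolve_right ha
  have hone : w c = 1 := by
    rw [← hw1, Finset.sum_eq_single c (fun c' _ hc => hzero c' hc) (by simp)]
  refine ⟨f c, hf c, ?_⟩
  rw [Finset.sum_eq_single c (fun c' _ hc => by rw [hzero c' hc, zero_smul]) (by simp), hone,
    one_smul]

theorem nonneg_of_mem_LF {p : S.Table} (hp : p ∈ S.LF) (x : S.Context) (a : S.Outcome x) :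
    0 ≤ p x a := by
  obtain ⟨w, f, hw, -, hf, rfl⟩ := mem_LF_iff.1 hp
  simp only [Finset.sum_apply, Pi.smul_apply, smul_eq_mul]
  exact Finset.sum_nonneg fun c _ => mul_nonneg (hw c) (combine_nonneg c (hf c) x a)

theorem combine_mem_extremePoints (c : S.FriendOutcome) {e : S.reduced.Table}
    (he : e ∈ extremePoints ℝ S.reduced.NS) : combine c e ∈ extremePoints ℝ S.LF := by
  refine mem_extremePoints.2 ⟨combine_mem_LF c he.1, fun p hp q hq hpq => ?_⟩
  obtain ⟨s, t, hs, ht, hst, heq⟩ := hpq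
  have hval : ∀ x a, s * p x a + t * q x a = combine c e x a := fun x a => by
    rw [← heq]; rfl
  obtain ⟨f, hf, rfl⟩ := eq_combine_of_support_subset (c := c) (e := e) hp fun x a h0 => by
    have := hval x a
    nlinarith [nonneg_of_mem_LF hp x a, mul_nonneg ht.le (nonneg_of_mem_LF hq x a)]
  obtain ⟨g, hg, rfl⟩ := eq_combine_of_support_subset (c := c) (e := e) hq fun x a h0 => by
    have := hval x a
    nlinarith [nonneg_of_mem_LF hq x a, mul_nonneg hs.le (nonneg_of_mem_LF hp x a)]
  -- Apply `restrict` to the decomposition of `combine c e`.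
  have hefg : s • f + t • g = e := by
    rw [← restrict_combine c he.1, ← heq, ← combine_smul, ← combine_smul, ← combine_add,
      restrict_combine c (convex_NS hf hg hs.le ht.le hst)]
  obtain ⟨rfl, rfl⟩ := (mem_extremePoints.1 he).2 f hf g hg ⟨s, t, hs, ht, hst, hefg⟩
  exact ⟨rfl, rfl⟩

theorem combine_injective {c d : S.FriendOutcome} {e f : S.reduced.Table} (he : e ∈ S.reduced.NS)
    (hf : f ∈ S.reduced.NS) (h : combine c e = combine d f) : c = d ∧ e = f := by
  refine ⟨?_, by rw [← restrict_combine c he, h, restrict_combine d hf]⟩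
  obtain ⟨a, -, ha⟩ : ∃ a ∈ Finset.univ, combine c e S.queryContext a ≠ 0 := by
    refine Finset.exists_ne_zero_of_sum_ne_zero ?_
    rw [sum_combine c he]
    exact one_ne_zero
  have key : ∀ (c' : S.FriendOutcome) (e' : S.reduced.Table),
      combine c' e' S.queryContext a ≠ 0 → ∀ i : S.friends, (a i.1 : ℕ) = c' i := by
    intro c' e' hne
    by_contra hcon
    refine hne ?_
    rw [combine, queryDelta_eq,
      if_neg fun hall => hcon fun i => hall i (mem_querying.2 ⟨i.2, rfl⟩), zero_mul]
  exact funext fun i => Subtype.ext ((key c e ha i).symm.trans (key d f (h ▸ ha) i))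

end CanonicalScenario

end LocalFriendliness

end

/-- The set of Local Friendliness behaviours is a convex polytope, and its extreme points are in
bijection, through `combine`, with the pairs of a string of friends' outcomes and an extreme point
of the no-signalling polytope of the reduced scenario. -/
theorem mainTheorem6 (S : LocalFriendliness.CanonicalScenario) :
    LocalFriendliness.IsConvexPolytope S.LF ∧
      Set.BijOn
        (fun μ : S.FriendOutcome × S.reduced.Table =>
          LocalFriendliness.CanonicalScenario.combine μ.1 μ.2)
        (Set.univ ×ˢ Set.extremePoints ℝ S.reduced.NS)
        (Set.extremePoints ℝ S.LF) := by
  open LocalFriendliness CanonicalScenario in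
  refine ⟨⟨S.vertices, finite_vertices, LF_eq_convexHull_vertices⟩, ?_, ?_, ?_⟩
  · rintro ⟨c, e⟩ ⟨-, he⟩
    exact combine_mem_extremePoints c he
  · rintro ⟨c, e⟩ ⟨-, he⟩ ⟨d, f⟩ ⟨-, hf⟩ h
    obtain ⟨rfl, rfl⟩ := combine_injective he.1 hf.1 h
    rfl
  · intro p hp
    rw [LF_eq_convexHull_vertices] at hp
    exact extremePoints_convexHull_subset hp
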